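/- Let $m\ge 1$ be an integer and let $\theta_1,\theta_2>1$, $\kappa_A,\kappa_B>0$, $\kappa_C\ge 1$, $\sigma_0>0$, $L\ge 3$. For every twice continuously differentiable $f:\mathbb{R}^n\to\mathbb{R}$ (any $n$) that is bounded below by some $f_{\rm low}$ and satisfies $\|\nabla^2 f(y)-\nabla^2 f(z)\|\le L\|y-z\|$ for all $y,z\in\mathbb{R}^n$ (vectors carry the Euclidean norm and matrices the induced operator norm), consider any sequences of iterates $x_k\in\mathbb{R}^n$, steps $s_k\in\mathbb{R}^n$, matrices $B_k\in\mathbb{R}^{n\times n}$ and parameters $\sigma_k$ ($k\ge 0$) generated by Algorithm ARp-approx with $p=2$. This means that $x_0\in\mathbb{R}^n$ is arbitrary, $\sigma_0$ is the given number, and, with the convention $\|s_j\|=1$ for $j<0$ and with $$\overline{T}_k(s)=f(x_k)+\nabla f(x_k)^\top s+\tfrac12 s^\top B_k s,\qquad m_k(s)=\overline{T}_k(s)+\tfrac{\sigma_k}{6}\|s\|^3,\qquad \widetilde B_{k}=\int_0^1\nabla^2 f(x_{k}+ts_{k})\,dt,$$ the following hold for every $k\ge 0$: - if $k \bmod m=0$,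 then $\|B_k-\nabla^2 f(x_k)\|\le\min\bigl(\kappa_A\sum_{i=1}^m\|s_{k-i}\|,\ \kappa_B\bigr)$; - if $k\bmod m\ne 0$, then $\|B_k-\widetilde B_{k-1}\|\le\kappa_C\|B_{k-1}-\widetilde B_{k-1}\|$; - $m_k(s_k)-m_k(0)\le 0$, $\ \|\nabla\overline{T}_k(s_k)\|\le\frac{\theta_1\sigma_k\|s_k\|^2}{2}$, and $\ \max[0,-\lambda_{\min}(\nabla^2\overline{T}_k(s_k))]\le\theta_2\sigma_k\|s_k\|$; - $x_{k+1}=x_k+s_k$ and $\sigma_{k+1}=\sigma_k+\sigma_k\|s_k\|^3$. Then, for every $k\ge 0$, $$\min_{1\le j\le k+1}\|\nabla f(x_j)\|\le\frac{C_1}{(k+1)^{2/3}},\qquad \min_{1\le j\le k+1}\max[0,-\lambda_{\min}(\nabla^2 f(x_j))]\le\frac{C_2}{(k+1)^{1/3}},$$ where the constants $C_1,C_2$ depend only on $m,\theta_1,\theta_2,\kappa_A,\kappa_B,\kappa_C,\sigma_0,L$ and on upper bounds for $f(x_0)-f_{\rm low}$, $\|\nabla f(x_0)\|$ and $\max[0,-\lambda_{\min}(\nabla^2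 f(x_0))]$; in particular they depend neither on $k$ or $n$ nor on the choice of the matrices $B_k$ and the steps $s_k$. No bound on $B_k$ or on its curvature is assumed. (Here $\lambda_{\min}$ is the leftmost eigenvalue of a symmetric matrix, and $\max[0,-\lambda_{\min}]=0$ if $n=0$.) -/

import Mathlib

noncomputable section

namespace ARApprox

/-- The Hessian of `f` at `x`, as the linear operator `d ↦ ∇²f(x) d`. -/
def hessian {n : ℕ} (f : EuclideanSpace ℝ (Fin n) → ℝ) (x : EuclideanSpace ℝ (Fin n)) :
    EuclideanSpace ℝ (Fin n) →L[ℝ] EuclideanSpace ℝ (Fin n) :=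
  fderiv ℝ (gradient f) x

/-- The leftmost (real) eigenvalue of an operator. In dimension zero there is no eigenvalue and
the value is `0`. -/
def lambdaMin {n : ℕ} (A : EuclideanSpace ℝ (Fin n) →L[ℝ] EuclideanSpace ℝ (Fin n)) : ℝ :=
  sInf {μ : ℝ | Module.End.HasEigenvalue
    (A : EuclideanSpace ℝ (Fin n) →ₗ[ℝ] EuclideanSpace ℝ (Fin n)) μ}

/-- `max[0, -λ_min(∇²f(x))]`. -/
def negCurvature {n : ℕ} (f : EuclideanSpace ℝ (Fin n) → ℝ) (x : EuclideanSpace ℝ (Fin n)) : ℝ :=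
  max 0 (-lambdaMin (hessian f x))

/-- The second-order Taylor expansion of `f` at `x`, as a function of the step, with the matrix `B`
in place of the Hessian. -/
def approxTaylor {n : ℕ} (f : EuclideanSpace ℝ (Fin n) → ℝ) (x : EuclideanSpace ℝ (Fin n))
    (B : EuclideanSpace ℝ (Fin n) →L[ℝ] EuclideanSpace ℝ (Fin n))
    (s : EuclideanSpace ℝ (Fin n)) : ℝ :=
  f x + inner ℝ (gradient f x) s + (1 / 2) * inner ℝ s (B s)

/-- The cubically regularized model. -/
def model {n : ℕ} (f : EuclideanSpace ℝ (Fin n) → ℝ) (x : EuclideanSpace ℝ (Fin n))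
    (B : EuclideanSpace ℝ (Fin n) →L[ℝ] EuclideanSpace ℝ (Fin n)) (σ : ℝ)
    (s : EuclideanSpace ℝ (Fin n)) : ℝ :=
  approxTaylor f x B s + σ / 6 * ‖s‖ ^ 3

/-- The Hessian of `f` averaged over the segment from `x` to `x + s`. -/
def averagedHessian {n : ℕ} (f : EuclideanSpace ℝ (Fin n) → ℝ) (x s : EuclideanSpace ℝ (Fin n)) :
    EuclideanSpace ℝ (Fin n) →L[ℝ] EuclideanSpace ℝ (Fin n) :=
  ∫ t in (0 : ℝ)..1, hessian f (x + t • s)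

/-- The step lengths `‖s_j‖`, with the convention `‖s_j‖ = 1` for `j < 0`. -/
def stepLength {n : ℕ} (s : ℕ → EuclideanSpace ℝ (Fin n)) (j : ℤ) : ℝ :=
  if j < 0 then 1 else ‖s j.toNat‖

/-- The sequences `x`, `s`, `B`, `σ` of iterates, steps, Hessian approximations and regularization
parameters are generated on `f` by the second-order (`p = 2`) instance of the adaptive
regularization algorithm with approximate tensor, with memory length `m` and the
parameters `θ₁, θ₂, κA, κB, κC, σ₀`. -/
structure IsRun {n : ℕ} (m : ℕ) (θ₁ θ₂ κA κB κC σ₀ : ℝ)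
    (f : EuclideanSpace ℝ (Fin n) → ℝ)
    (x s : ℕ → EuclideanSpace ℝ (Fin n))
    (B : ℕ → EuclideanSpace ℝ (Fin n) →L[ℝ] EuclideanSpace ℝ (Fin n))
    (σ : ℕ → ℝ) : Prop where
  sigma_zero : σ 0 = σ₀
  /-- Accuracy of the approximation when it is recomputed. -/
  refresh : ∀ k : ℕ, k % m = 0 →
    ‖B k - hessian f (x k)‖ ≤
      min (κA * ∑ i ∈ Finset.Icc 1 m, stepLength s ((k : ℤ) - (i : ℤ))) κB
  /-- Accuracy of the approximation at the other iterations. -/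
  update : ∀ k : ℕ, (k + 1) % m ≠ 0 →
    ‖B (k + 1) - averagedHessian f (x k) (s k)‖ ≤
      κC * ‖B k - averagedHessian f (x k) (s k)‖
  model_decrease : ∀ k : ℕ,
    model f (x k) (B k) (σ k) (s k) - model f (x k) (B k) (σ k) 0 ≤ 0
  step_gradient : ∀ k : ℕ,
    ‖gradient (approxTaylor f (x k) (B k)) (s k)‖ ≤ θ₁ * σ k * ‖s k‖ ^ 2 / 2
  step_curvature : ∀ k : ℕ,
    negCurvature (approxTaylor f (x k) (B k)) (s k) ≤ θ₂ * σ k * ‖s k‖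
  iterate_succ : ∀ k : ℕ, x (k + 1) = x k + s k
  sigma_succ : ∀ k : ℕ, σ (k + 1) = σ k + σ k * ‖s k‖ ^ 3

end ARApprox

end

/-! The run is reduced to scalar recursions (`ScalarRun`) for `ω k = ‖s k‖`, in which the dimension
and `B k` enter only through the error `e k = ‖B k - ∇²f(x k)‖`. By `error_le_window`, `e k` is at
most a constant times the sum of the previous `2 * m` step lengths, so `∑ e k * ω k ^ 2` is
controlled by `∑ ω k ^ 3` plus a constant.

The decrease of `f` beats these errors once `σ` exceeds a fixed threshold. Below the threshold, `∑ ω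
k ^ 3` is bounded because `σ` itself grows with it; only the step that crosses the threshold can be
large, and `exists_step_bound` controls it: the gradient and curvature at the current iterate are
bounded by the tests passed at the previous one (or by the data at `x 0`). This replaces any bound
on `B k`.

Telescoping then bounds `∑ ω k ^ 3` (`exists_sum_cube_bound`), hence also `σ`. By averaging, some
step and its window have total length of order `(k + 1) ^ (-1/3)`; the next gradient is quadratic in
that length and the next negative curvature linear (`exists_rate`). -/

namespace ARApprox

/-! ### Sums over windows of past steps -/

/-- The value `i` indices before `k`, with the convention that values at negative indices are `1`. -/
def lag (ω : ℕ → ℝ) (i k : ℕ) : ℝ := if k < i then 1 else ω (k - i)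

/-- The sum of the `N` values preceding index `k`. -/
def window (ω : ℕ → ℝ) (N k : ℕ) : ℝ := ∑ i ∈ Finset.range N, lag ω (i + 1) k

theorem lag_zero (ω : ℕ → ℝ) (k : ℕ) : lag ω 0 k = ω k := by simp [lag]

theorem lag_succ_succ (ω : ℕ → ℝ) (i k : ℕ) : lag ω (i + 1) (k + 1) = lag ω i k := by
  simp [lag]

theorem lag_succ_zero (ω : ℕ → ℝ) (i : ℕ) : lag ω (i + 1) 0 = 1 := by simp [lag]

theorem lag_nonneg {ω : ℕ → ℝ} (h : ∀ k, 0 ≤ ω k) (i k : ℕ) : 0 ≤ lag ω i k := by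
  unfold lag; split_ifs <;> simp [h]

theorem window_nonneg {ω : ℕ → ℝ} (h : ∀ k, 0 ≤ ω k) (N k : ℕ) : 0 ≤ window ω N k :=
  Finset.sum_nonneg fun _ _ => lag_nonneg h _ _

theorem window_mono {ω : ℕ → ℝ} (h : ∀ k, 0 ≤ ω k) {M N : ℕ} (hMN : M ≤ N) (k : ℕ) :
    window ω M k ≤ window ω N k :=
  Finset.sum_le_sum_of_subset_of_nonneg (Finset.range_mono hMN) fun _ _ _ => lag_nonneg h _ _

theorem window_succ_succ (ω : ℕ → ℝ) (N k : ℕ) :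
    window ω (N + 1) (k + 1) = window ω N k + ω k := by
  simp [window, Finset.sum_range_succ', lag_succ_succ, lag_zero]

theorem window_le {ω : ℕ → ℝ} {Y : ℝ} (hY : 1 ≤ Y) (N k : ℕ) (h : ∀ j < k, ω j ≤ Y) :
    window ω N k ≤ N * Y := by
  have : ∀ i ∈ Finset.range N, lag ω (i + 1) k ≤ Y := by
    intro i _
    unfold lag
    split_ifs with hk
    · exact hY
    · exact h _ (by omega)
  simpa [window] using Finset.sum_le_card_nsmul _ _ _ this

/-- A shift by `i` drops terms at the end and brings in at most `i` conventional values `1` at the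
start. -/
theorem sum_lag_cube_le {ω : ℕ → ℝ} (h : ∀ k, 0 ≤ ω k) (i K : ℕ) :
    ∑ k ∈ Finset.range K, lag ω i k ^ 3 ≤ ∑ k ∈ Finset.range K, ω k ^ 3 + i := by
  induction i generalizing K with
  | zero => simp [lag_zero]
  | succ i ih =>
    cases K with
    | zero => simp; positivity
    | succ K =>
      rw [Finset.sum_range_succ', Finset.sum_range_succ _ K]
      simp only [lag_succ_succ, lag_succ_zero]
      have := ih K
      have := pow_nonneg (h K) 3
      push_cast
      linarith

theorem sum_window_cube_le {ω : ℕ → ℝ} (h : ∀ k, 0 ≤ ω k) (N K : ℕ) :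
    ∑ k ∈ Finset.range K, window ω N k ^ 3 ≤
      (N : ℝ) ^ 3 * (∑ k ∈ Finset.range K, ω k ^ 3 + N) := by
  calc ∑ k ∈ Finset.range K, window ω N k ^ 3
      ≤ ∑ k ∈ Finset.range K, (N : ℝ) ^ 2 * ∑ i ∈ Finset.range N, lag ω (i + 1) k ^ 3 := by
        refine Finset.sum_le_sum fun k _ => ?_
        simpa [window] using pow_sum_le_card_mul_sum_pow (s := Finset.range N)
          (fun i _ => lag_nonneg h (i + 1) k) 2
    _ = (N : ℝ) ^ 2 * ∑ i ∈ Finset.range N, ∑ k ∈ Finset.range K, lag ω (i + 1) k ^ 3 := by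
        rw [← Finset.mul_sum, Finset.sum_comm]
    _ ≤ (N : ℝ) ^ 2 * ∑ _i ∈ Finset.range N, (∑ k ∈ Finset.range K, ω k ^ 3 + N) := by
        gcongr with i hi
        refine (sum_lag_cube_le h (i + 1) K).trans ?_
        have : i + 1 ≤ N := Finset.mem_range.1 hi
        gcongr
    _ = _ := by simp; ring

/-! ### Growth of the regularization parameter, and elementary cubic bounds -/

theorem sigma_mono {ω σ : ℕ → ℝ} {σ₀ : ℝ} (hσ₀ : 0 < σ₀) (hω : ∀ k, 0 ≤ ω k) (h0 : σ 0 = σ₀)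
    (hs : ∀ k, σ (k + 1) = σ k + σ k * ω k ^ 3) : (∀ k, σ₀ ≤ σ k) ∧ Monotone σ := by
  have h1 : ∀ k, σ₀ ≤ σ k := by
    intro k
    induction k with
    | zero => exact h0.ge
    | succ k ih =>
      have := mul_nonneg (hσ₀.le.trans ih) (pow_nonneg (hω k) 3)
      rw [hs]; linarith
  refine ⟨h1, monotone_nat_of_le_succ fun k => ?_⟩
  have := mul_nonneg (hσ₀.le.trans (h1 k)) (pow_nonneg (hω k) 3)
  rw [hs]; linarith

theorem sum_cube_le_sigma {ω σ : ℕ → ℝ} {σ₀ : ℝ} (hσ₀ : 0 < σ₀) (hω : ∀ k, 0 ≤ ω k)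
    (h0 : σ 0 = σ₀) (hs : ∀ k, σ (k + 1) = σ k + σ k * ω k ^ 3) (K : ℕ) :
    σ₀ * ∑ k ∈ Finset.range K, ω k ^ 3 ≤ σ K := by
  have h1 := (sigma_mono hσ₀ hω h0 hs).1
  induction K with
  | zero => simpa [h0] using hσ₀.le
  | succ K ih =>
    rw [Finset.sum_range_succ, hs, mul_add]
    exact add_le_add ih (mul_le_mul_of_nonneg_right (h1 K) (pow_nonneg (hω K) 3))

/-- `σ` is a product of factors `1 + ω k ^ 3`, each at most `exp (ω k ^ 3)`. -/
theorem sigma_le_exp {ω σ : ℕ → ℝ} {σ₀ : ℝ} (hσ₀ : 0 < σ₀) (hω : ∀ k, 0 ≤ ω k)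
    (h0 : σ 0 = σ₀) (hs : ∀ k, σ (k + 1) = σ k + σ k * ω k ^ 3) (K : ℕ) :
    σ K ≤ σ₀ * Real.exp (∑ k ∈ Finset.range K, ω k ^ 3) := by
  induction K with
  | zero => simp [h0]
  | succ K ih =>
    rw [Finset.sum_range_succ, hs, Real.exp_add]
    have h2 := Real.add_one_le_exp (ω K ^ 3)
    have h3 := pow_nonneg (hω K) 3
    calc σ K + σ K * ω K ^ 3 = σ K * (ω K ^ 3 + 1) := by ring
      _ ≤ (σ₀ * Real.exp (∑ k ∈ Finset.range K, ω k ^ 3)) * Real.exp (ω K ^ 3) := by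
        gcongr
      _ = _ := by ring

theorem le_of_cubic_le {σ₀ Γ X w : ℝ} (hσ₀ : 0 < σ₀) (hΓ : 0 ≤ Γ) (hX : 0 ≤ X) (hw : 0 ≤ w)
    (h : σ₀ / 6 * w ^ 3 ≤ Γ * w + X * w ^ 2) : w ≤ 1 + 6 * (Γ + X) / σ₀ := by
  rcases le_or_gt w 1 with h1 | h1
  · have : 0 ≤ 6 * (Γ + X) / σ₀ := by positivity
    linarith
  · have h2 : σ₀ / 6 * w * w ^ 2 ≤ (Γ + X) * w ^ 2 := by
      have : Γ * w ≤ Γ * w ^ 2 := by gcongr; nlinarith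
      nlinarith
    have h3 := le_of_mul_le_mul_right h2 (by positivity)
    have : w ≤ 6 * (Γ + X) / σ₀ := by
      rw [le_div_iff₀ hσ₀]; linarith
    linarith

theorem le_one_add_of_cube_le {w c : ℝ} (hc : 0 ≤ c) (h : w ^ 3 ≤ c) : w ≤ 1 + c := by
  rcases le_or_gt w 1 with h1 | h1
  · linarith
  · nlinarith [sq_nonneg w, mul_pos (sub_pos.2 h1) (zero_lt_one.trans h1)]

/-! ### The scalar recursion: step bound, summability, rates -/

/-- The scalar relations between consecutive iterations: `ω` step lengths, `F` function values,
`g` gradient norms, `χ` negative curvatures, `e` Hessian errors. -/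
structure ScalarRun (N : ℕ) (κ L θ₁ θ₂ σ₀ : ℝ) (ω σ F g χ e : ℕ → ℝ) : Prop where
  step_nonneg : ∀ k, 0 ≤ ω k
  sigma_zero : σ 0 = σ₀
  sigma_succ : ∀ k, σ (k + 1) = σ k + σ k * ω k ^ 3
  decrease : ∀ k, F (k + 1) ≤ F k - σ k / 6 * ω k ^ 3 + L * ω k ^ 3 + e k * ω k ^ 2
  step_le : ∀ k, σ k / 6 * ω k ^ 3 ≤ g k * ω k + (χ k + e k) * ω k ^ 2
  gradient_succ : ∀ k, g (k + 1) ≤ (L + θ₁ * σ k / 2) * ω k ^ 2 + e k * ω k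
  curvature_succ : ∀ k, χ (k + 1) ≤ e k + (L + θ₂ * σ k) * ω k
  error_le : ∀ k, e k ≤ κ * window ω N k

namespace ScalarRun

/-- Steps taken while `σ` is below a threshold `M` are bounded. -/
theorem exists_step_bound (N : ℕ) (κ L θ₁ θ₂ σ₀ G β M : ℝ) (hκ : 0 ≤ κ) (hL : 0 ≤ L)
    (hθ₁ : 0 ≤ θ₁) (hθ₂ : 0 ≤ θ₂) (hσ₀ : 0 < σ₀) (hM : 0 ≤ M) :
    ∃ R : ℝ, 0 ≤ R ∧ ∀ ω σ F g χ e : ℕ → ℝ, ScalarRun N κ L θ₁ θ₂ σ₀ ω σ F g χ e →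
      g 0 ≤ G → χ 0 ≤ β → ∀ k, σ k < M → ω k ≤ R := by
  -- `σ k < M` bounds the sum of the earlier cubes by `M / σ₀`, hence every earlier step by `Y`.
  -- Since `Y ≥ 1`, it also covers the values at negative indices.
  set Y : ℝ := 1 + M / σ₀ with hYdef
  have hMσ : 0 ≤ M / σ₀ := by positivity
  have hY : 1 ≤ Y := by linarith
  have hY0 : 0 ≤ Y := by linarith
  set E : ℝ := κ * (N * Y) with hE
  have hE0 : 0 ≤ E := by positivity
  set Γ : ℝ := |G| + ((L + θ₁ * M / 2) * Y ^ 2 + E * Y) with hΓ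
  set X : ℝ := |β| + (E + (L + θ₂ * M) * Y) with hX
  have hΓ0 : 0 ≤ Γ := by positivity
  have hX0 : 0 ≤ X := by positivity
  refine ⟨1 + 6 * (Γ + (X + E)) / σ₀, by positivity, ?_⟩
  intro ω σ F g χ e h hG hβ k hk
  obtain ⟨hσ, hmono⟩ := sigma_mono hσ₀ h.step_nonneg h.sigma_zero h.sigma_succ
  have hω : ∀ j < k, ω j ≤ Y := by
    intro j hj
    apply le_one_add_of_cube_le hMσ
    rw [le_div_iff₀ hσ₀]
    have h1 := sum_cube_le_sigma hσ₀ h.step_nonneg h.sigma_zero h.sigma_succ k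
    have h2 := Finset.single_le_sum (f := fun k => ω k ^ 3)
      (fun i _ => pow_nonneg (h.step_nonneg i) 3) (Finset.mem_range.2 hj)
    have := mul_le_mul_of_nonneg_left h2 hσ₀.le
    linarith
  have he : ∀ j ≤ k, e j ≤ E := fun j hj => (h.error_le j).trans <|
    mul_le_mul_of_nonneg_left (window_le hY N j fun i hi => hω i (by omega)) hκ
  have hgχ : g k ≤ Γ ∧ χ k ≤ X := by
    cases k with
    | zero =>
      constructor
      · have : 0 ≤ (L + θ₁ * M / 2) * Y ^ 2 + E * Y := by positivity
        linarith [le_abs_self G]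
      · have : 0 ≤ E + (L + θ₂ * M) * Y := by positivity
        linarith [le_abs_self β]
    | succ k =>
      have hσk : σ k ≤ M := (hmono k.le_succ).trans hk.le
      have hσ0 : 0 ≤ σ k := hσ₀.le.trans (hσ k)
      have hωk := hω k k.lt_succ_self
      have hek := he k k.le_succ
      have h0 := h.step_nonneg k
      constructor
      · calc g (k + 1) ≤ (L + θ₁ * σ k / 2) * ω k ^ 2 + e k * ω k := h.gradient_succ k
          _ ≤ (L + θ₁ * M / 2) * Y ^ 2 + E * Y := by gcongr
          _ ≤ Γ := by linarith [abs_nonneg G]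
      · calc χ (k + 1) ≤ e k + (L + θ₂ * σ k) * ω k := h.curvature_succ k
          _ ≤ E + (L + θ₂ * M) * Y := by gcongr
          _ ≤ X := by linarith [abs_nonneg β]
  have h0 := h.step_nonneg k
  refine le_of_cubic_le hσ₀ hΓ0 (add_nonneg hX0 hE0) h0 ?_
  calc σ₀ / 6 * ω k ^ 3 ≤ σ k / 6 * ω k ^ 3 := by gcongr; exact hσ k
    _ ≤ g k * ω k + (χ k + e k) * ω k ^ 2 := h.step_le k
    _ ≤ Γ * ω k + (X + E) * ω k ^ 2 := by
      gcongr
      exacts [hgχ.1, hgχ.2, he k le_rfl]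

/-- The cubes of the step lengths are summable, with a uniform bound. -/
theorem exists_sum_cube_bound (N : ℕ) (κ L θ₁ θ₂ σ₀ Δ G β : ℝ) (hκ : 0 ≤ κ) (hL : 0 < L)
    (hθ₁ : 0 ≤ θ₁) (hθ₂ : 0 ≤ θ₂) (hσ₀ : 0 < σ₀) :
    ∃ S : ℝ, ∀ (ω σ F g χ e : ℕ → ℝ) (F_low : ℝ), ScalarRun N κ L θ₁ θ₂ σ₀ ω σ F g χ e →
      (∀ k, F_low ≤ F k) → F 0 - F_low ≤ Δ → g 0 ≤ G → χ 0 ≤ β →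
      ∀ K, ∑ k ∈ Finset.range K, ω k ^ 3 ≤ S := by
  -- The total coefficient of `∑ ω k ^ 3` in the error terms. For `σ k ≥ 12 * c` the gain `σ k / 6`
  -- is at least `2 * c`, twice that coefficient.
  set c : ℝ := L + κ * (N ^ 3 + 1) with hc
  have hc0 : 0 < c := by positivity
  obtain ⟨R, hR, hstep⟩ := exists_step_bound N κ L θ₁ θ₂ σ₀ G β (12 * c) hκ hL.le hθ₁ hθ₂ hσ₀
    (by positivity)
  -- The last step taken below the threshold contributes at most `R ^ 3`, and all those before it at
  -- most `12 * c / σ₀`.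
  set A : ℝ := 12 * c / σ₀ + R ^ 3 with hA
  have hA0 : 0 ≤ A := by positivity
  -- With `Σ` the sum of cubes, telescoping gives `2c(Σ - A) ≤ Δ + cΣ + κN⁴`, which is solved for
  -- `Σ`.
  refine ⟨(Δ + κ * (N ^ 3 * N) + 2 * c * A) / c, ?_⟩
  intro ω σ F g χ e F_low h hlow hΔ hG hβ K
  have hω := h.step_nonneg
  obtain ⟨hσ, hmono⟩ := sigma_mono hσ₀ hω h.sigma_zero h.sigma_succ
  have hsmall : ∀ K, ∑ k ∈ Finset.range K, (if σ k < 12 * c then ω k ^ 3 else 0) ≤ A := by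
    intro K
    induction K with
    | zero => simpa using hA0
    | succ K ih =>
      rw [Finset.sum_range_succ]
      split_ifs with hK
      · refine add_le_add ?_ (pow_le_pow_left₀ (hω K) (hstep _ _ _ _ _ _ h hG hβ K hK) 3)
        rw [le_div_iff₀ hσ₀]
        have h1 := sum_cube_le_sigma hσ₀ hω h.sigma_zero h.sigma_succ K
        have h2 : ∑ k ∈ Finset.range K, (if σ k < 12 * c then ω k ^ 3 else 0)
            ≤ ∑ k ∈ Finset.range K, ω k ^ 3 := by
          refine Finset.sum_le_sum fun k _ => ?_
          have := pow_nonneg (hω k) 3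
          split_ifs <;> linarith
        have := mul_le_mul_of_nonneg_left h2 hσ₀.le
        linarith
      · simpa using ih
  have htel : ∑ k ∈ Finset.range K, (σ k / 6 * ω k ^ 3 - L * ω k ^ 3 - e k * ω k ^ 2) ≤ Δ := by
    have h1 : ∑ k ∈ Finset.range K, (σ k / 6 * ω k ^ 3 - L * ω k ^ 3 - e k * ω k ^ 2)
        ≤ ∑ k ∈ Finset.range K, (F k - F (k + 1)) :=
      Finset.sum_le_sum fun k _ => by linarith [h.decrease k]
    rw [Finset.sum_range_sub'] at h1
    linarith [hlow K]
  have herr : ∑ k ∈ Finset.range K, e k * ω k ^ 2 ≤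
      κ * (N ^ 3 * (∑ k ∈ Finset.range K, ω k ^ 3 + N) + ∑ k ∈ Finset.range K, ω k ^ 3) := by
    calc ∑ k ∈ Finset.range K, e k * ω k ^ 2
        ≤ ∑ k ∈ Finset.range K, κ * (window ω N k ^ 3 + ω k ^ 3) := by
          refine Finset.sum_le_sum fun k _ => ?_
          have hv := window_nonneg hω N k
          have hw := hω k
          calc e k * ω k ^ 2 ≤ κ * window ω N k * ω k ^ 2 := by gcongr; exact h.error_le k
            _ = κ * (window ω N k * ω k ^ 2) := by ring
            _ ≤ κ * (window ω N k ^ 3 + ω k ^ 3) := by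
              gcongr
              -- The product is at most the cube of the larger factor.
              rcases le_total (window ω N k) (ω k) with hle | hle
              · have := mul_le_mul_of_nonneg_right hle (sq_nonneg (ω k))
                have := pow_nonneg hv 3
                linarith [pow_succ' (ω k) 2]
              · have := mul_le_mul_of_nonneg_left (pow_le_pow_left₀ hw hle 2) hv
                have := pow_nonneg hw 3
                linarith [pow_succ' (window ω N k) 2]
      _ ≤ _ := by
          rw [← Finset.mul_sum, Finset.sum_add_distrib]
          gcongr
          exact sum_window_cube_le hω N K
  have hpoint : ∑ k ∈ Finset.range K, 2 * c * (ω k ^ 3 - if σ k < 12 * c then ω k ^ 3 else 0) ≤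
      ∑ k ∈ Finset.range K, σ k / 6 * ω k ^ 3 := by
    refine Finset.sum_le_sum fun k _ => ?_
    have h3 := pow_nonneg (hω k) 3
    have := hσ k
    split_ifs with hk
    · rw [sub_self, mul_zero]
      exact mul_nonneg (by linarith) h3
    · rw [sub_zero]
      exact mul_le_mul_of_nonneg_right (by linarith) h3
  rw [← Finset.mul_sum, Finset.sum_sub_distrib] at hpoint
  rw [Finset.sum_sub_distrib, Finset.sum_sub_distrib, ← Finset.mul_sum] at htel
  rw [le_div_iff₀ hc0]
  have := mul_le_mul_of_nonneg_left (hsmall K) (by positivity : 0 ≤ 2 * c)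
  have hcS : (∑ k ∈ Finset.range K, ω k ^ 3) * c = L * (∑ k ∈ Finset.range K, ω k ^ 3) +
    κ * (N ^ 3 * (∑ k ∈ Finset.range K, ω k ^ 3) + ∑ k ∈ Finset.range K, ω k ^ 3) := by
    rw [hc]; ring
  linarith

/-- Among the first `k + 1` iterations there is one after which both optimality measures are
small. -/
theorem exists_rate (N : ℕ) (κ L θ₁ θ₂ σ₀ Δ G β : ℝ) (hκ : 0 ≤ κ) (hL : 0 < L)
    (hθ₁ : 0 ≤ θ₁) (hθ₂ : 0 ≤ θ₂) (hσ₀ : 0 < σ₀) :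
    ∃ C₁ C₂ : ℝ, ∀ (ω σ F g χ e : ℕ → ℝ) (F_low : ℝ), ScalarRun N κ L θ₁ θ₂ σ₀ ω σ F g χ e →
      (∀ k, F_low ≤ F k) → F 0 - F_low ≤ Δ → g 0 ≤ G → χ 0 ≤ β →
      ∀ k : ℕ, ∃ j ≤ k, g (j + 1) ≤ C₁ / ((k : ℝ) + 1) ^ (2 / 3 : ℝ) ∧
        χ (j + 1) ≤ C₂ / ((k : ℝ) + 1) ^ (1 / 3 : ℝ) := by
  obtain ⟨S, hS⟩ := exists_sum_cube_bound N κ L θ₁ θ₂ σ₀ Δ G β hκ hL hθ₁ hθ₂ hσ₀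
  set T : ℝ := σ₀ * Real.exp S with hT
  have hT0 : 0 ≤ T := by positivity
  -- Bounds `∑ (window + ω) ^ 3`; the `4` comes from `(a + b) ^ 3 ≤ 4 * (a ^ 3 + b ^ 3)`.
  set D : ℝ := 4 * ((N : ℝ) ^ 3 * (S + N) + S) with hD
  set P : ℝ := L + θ₁ * T / 2 + κ with hP
  set Q : ℝ := κ + (L + θ₂ * T) with hQ
  refine ⟨P * D ^ (2 / 3 : ℝ), Q * D ^ (1 / 3 : ℝ), ?_⟩
  intro ω σ F g χ e F_low h hlow hΔ hG hβ k
  have hω := h.step_nonneg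
  have hSb := hS _ _ _ _ _ _ _ h hlow hΔ hG hβ
  obtain ⟨hσ, hmono⟩ := sigma_mono hσ₀ hω h.sigma_zero h.sigma_succ
  have hσle : ∀ k, σ k ≤ T := fun k =>
    (sigma_le_exp hσ₀ hω h.sigma_zero h.sigma_succ k).trans (by rw [hT]; gcongr; exact hSb k)
  have hsum : ∑ j ∈ Finset.range (k + 1), (window ω N j + ω j) ^ 3 ≤
      ∑ _j ∈ Finset.range (k + 1), D / ((k : ℝ) + 1) := by
    calc ∑ j ∈ Finset.range (k + 1), (window ω N j + ω j) ^ 3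
        ≤ ∑ j ∈ Finset.range (k + 1), 4 * (window ω N j ^ 3 + ω j ^ 3) := by
          refine Finset.sum_le_sum fun j _ => ?_
          have := add_pow_le (window_nonneg hω N j) (hω j) 3
          norm_num at this
          exact this
      _ ≤ D := by
          rw [← Finset.mul_sum, Finset.sum_add_distrib, hD]
          have h1 := sum_window_cube_le hω N (k + 1)
          have h2 := hSb (k + 1)
          gcongr
          exact h1.trans (by gcongr)
      _ = _ := by
          rw [Finset.sum_const, Finset.card_range, nsmul_eq_mul]
          push_cast
          field_simp
  obtain ⟨j, hj, hjle⟩ := Finset.exists_le_of_sum_le ⟨0, by simp⟩ hsum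
  have hV := window_nonneg hω N j
  have hw := hω j
  set V := window ω N j with hVdef
  have hk : (0 : ℝ) < (k : ℝ) + 1 := by positivity
  -- The sign of `S` is not recorded, so that of `D` is read off from the cube it dominates.
  have hDnn : 0 ≤ D := by
    have : 0 ≤ D / ((k : ℝ) + 1) := le_trans (by positivity) hjle
    by_contra hneg
    exact absurd this (not_le.2 (div_neg_of_neg_of_pos (not_le.1 hneg) hk))
  have hW0 : 0 ≤ V + ω j := by positivity
  have hW1 : V + ω j ≤ D ^ (1 / 3 : ℝ) / ((k : ℝ) + 1) ^ (1 / 3 : ℝ) := by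
    rw [← Real.div_rpow hDnn hk.le]
    calc V + ω j = ((V + ω j) ^ 3) ^ (1 / 3 : ℝ) := by
          rw [← Real.rpow_natCast, ← Real.rpow_mul hW0]; norm_num
      _ ≤ _ := by gcongr
  have hW2 : (V + ω j) ^ 2 ≤ D ^ (2 / 3 : ℝ) / ((k : ℝ) + 1) ^ (2 / 3 : ℝ) := by
    rw [← Real.div_rpow hDnn hk.le]
    calc (V + ω j) ^ 2 = ((V + ω j) ^ 3) ^ (2 / 3 : ℝ) := by
          rw [← Real.rpow_natCast, ← Real.rpow_natCast, ← Real.rpow_mul hW0]; norm_num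
      _ ≤ _ := by gcongr
  have he : e j ≤ κ * (V + ω j) := (h.error_le j).trans (by gcongr; linarith)
  have hσ0 : 0 ≤ σ j := hσ₀.le.trans (hσ j)
  have hwW : ω j ≤ V + ω j := by linarith
  refine ⟨j, Nat.lt_succ_iff.1 (Finset.mem_range.1 hj), ?_, ?_⟩
  · calc g (j + 1) ≤ (L + θ₁ * σ j / 2) * ω j ^ 2 + e j * ω j := h.gradient_succ j
      _ ≤ (L + θ₁ * T / 2) * (V + ω j) ^ 2 + κ * (V + ω j) * (V + ω j) := by
        gcongr
        exact hσle j
      _ = P * (V + ω j) ^ 2 := by rw [hP]; ring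
      _ ≤ P * (D ^ (2 / 3 : ℝ) / ((k : ℝ) + 1) ^ (2 / 3 : ℝ)) := by gcongr
      _ = _ := by ring
  · calc χ (j + 1) ≤ e j + (L + θ₂ * σ j) * ω j := h.curvature_succ j
      _ ≤ κ * (V + ω j) + (L + θ₂ * T) * (V + ω j) := by
        gcongr
        exact hσle j
      _ = Q * (V + ω j) := by rw [hQ]; ring
      _ ≤ Q * (D ^ (1 / 3 : ℝ) / ((k : ℝ) + 1) ^ (1 / 3 : ℝ)) := by gcongr
      _ = _ := by ring

end ScalarRun

/-! ### Leftmost eigenvalues and symmetric parts -/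

section Curvature

variable {n : ℕ}

/-- For a symmetric operator the infimum of the Rayleigh quotient is an eigenvalue, so `lambdaMin`
lies below every quotient. -/
theorem neg_curvature_le_inner {A : EuclideanSpace ℝ (Fin n) →L[ℝ] EuclideanSpace ℝ (Fin n)}
    (hA : (A : EuclideanSpace ℝ (Fin n) →ₗ[ℝ] EuclideanSpace ℝ (Fin n)).IsSymmetric)
    (v : EuclideanSpace ℝ (Fin n)) :
    -(max 0 (-lambdaMin A)) * ‖v‖ ^ 2 ≤ inner ℝ v (A v) := by
  rcases eq_or_ne v 0 with rfl | hv
  · simp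
  have : Nontrivial (EuclideanSpace ℝ (Fin n)) := ⟨⟨v, 0, hv⟩⟩
  have h1 := hA.hasEigenvalue_iInf_of_finiteDimensional
  have h2 : lambdaMin A ≤ _ := csInf_le (Module.End.finite_hasEigenvalue _).bddBelow h1
  have hv' : 0 < ‖v‖ ^ 2 := by positivity
  have hbdd : BddBelow (Set.range fun x : { x : EuclideanSpace ℝ (Fin n) // x ≠ 0 } =>
      RCLike.re (inner ℝ (A x) (x : EuclideanSpace ℝ (Fin n))) / ‖(x : EuclideanSpace ℝ (Fin n))‖ ^ 2) := by
    refine ⟨-‖A‖, ?_⟩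
    rintro _ ⟨x, rfl⟩
    exact neg_le_of_abs_le (A.rayleighQuotient_le_norm x)
  have h3 := ciInf_le hbdd ⟨v, hv⟩
  have h4 : lambdaMin A ≤ inner ℝ (A v) v / ‖v‖ ^ 2 := h2.trans h3
  rw [le_div_iff₀ hv'] at h4
  rw [real_inner_comm] at h4
  have := le_max_right 0 (-lambdaMin A)
  nlinarith

theorem curvature_le_of_inner {A : EuclideanSpace ℝ (Fin n) →L[ℝ] EuclideanSpace ℝ (Fin n)}
    {c : ℝ} (hc : 0 ≤ c)
    (h : ∀ v : EuclideanSpace ℝ (Fin n), -c * ‖v‖ ^ 2 ≤ inner ℝ v (A v)) :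
    max 0 (-lambdaMin A) ≤ c := by
  refine max_le hc ?_
  rw [neg_le]
  unfold lambdaMin
  rcases Set.eq_empty_or_nonempty {μ : ℝ | Module.End.HasEigenvalue
    (A : EuclideanSpace ℝ (Fin n) →ₗ[ℝ] EuclideanSpace ℝ (Fin n)) μ} with he | he
  -- With no real eigenvalue, the infimum takes its default value `0`.
  · rw [he, Real.sInf_empty]; linarith
  · refine le_csInf he fun μ hμ => ?_
    obtain ⟨v, hv⟩ := Module.End.HasEigenvalue.exists_hasEigenvector hμ
    have h1 := h v
    have h2 : A v = μ • v := hv.apply_eq_smul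
    rw [h2, real_inner_smul_right, real_inner_self_eq_norm_sq] at h1
    exact le_of_mul_le_mul_right h1 (by have := norm_pos_iff.2 hv.2; positivity)

theorem inner_le_norm_mul_sq (A : EuclideanSpace ℝ (Fin n) →L[ℝ] EuclideanSpace ℝ (Fin n))
    (v : EuclideanSpace ℝ (Fin n)) : |inner ℝ v (A v)| ≤ ‖A‖ * ‖v‖ ^ 2 :=
  calc |inner ℝ v (A v)| ≤ ‖v‖ * ‖A v‖ := abs_real_inner_le_norm _ _
    _ ≤ ‖v‖ * (‖A‖ * ‖v‖) := by gcongr; exact A.le_opNorm v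
    _ = _ := by ring

/-- The symmetric part of an operator. -/
noncomputable def symPart (B : EuclideanSpace ℝ (Fin n) →L[ℝ] EuclideanSpace ℝ (Fin n)) :
    EuclideanSpace ℝ (Fin n) →L[ℝ] EuclideanSpace ℝ (Fin n) :=
  (1 / 2 : ℝ) • (B + ContinuousLinearMap.adjoint B)

theorem inner_symPart_left (B : EuclideanSpace ℝ (Fin n) →L[ℝ] EuclideanSpace ℝ (Fin n))
    (u v : EuclideanSpace ℝ (Fin n)) :
    inner ℝ (symPart B u) v = (1 / 2) * (inner ℝ (B u) v + inner ℝ u (B v)) := by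
  simp [symPart, inner_smul_left, inner_add_left, ContinuousLinearMap.adjoint_inner_left]
  ring

theorem symPart_isSymmetric (B : EuclideanSpace ℝ (Fin n) →L[ℝ] EuclideanSpace ℝ (Fin n)) :
    (symPart B : EuclideanSpace ℝ (Fin n) →ₗ[ℝ] EuclideanSpace ℝ (Fin n)).IsSymmetric := by
  intro u v
  change inner ℝ (symPart B u) v = inner ℝ u (symPart B v)
  rw [real_inner_comm (symPart B v) u, inner_symPart_left, inner_symPart_left,
    real_inner_comm v (B u), real_inner_comm u (B v)]
  ring

theorem inner_symPart_self (B : EuclideanSpace ℝ (Fin n) →L[ℝ] EuclideanSpace ℝ (Fin n))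
    (v : EuclideanSpace ℝ (Fin n)) : inner ℝ v (symPart B v) = inner ℝ v (B v) := by
  rw [real_inner_comm, inner_symPart_left, real_inner_comm v (B v)]
  ring

/-- `B k` need not be symmetric, but the derivatives of the model see only its symmetric part.
Passing to it costs no accuracy, because `H` is self-adjoint and taking adjoints is an isometry. -/
theorem norm_symPart_sub_le {B H : EuclideanSpace ℝ (Fin n) →L[ℝ] EuclideanSpace ℝ (Fin n)}
    (hH : (H : EuclideanSpace ℝ (Fin n) →ₗ[ℝ] EuclideanSpace ℝ (Fin n)).IsSymmetric) :
    ‖symPart B - H‖ ≤ ‖B - H‖ := by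
  have hadj : ContinuousLinearMap.adjoint H = H :=
    (ContinuousLinearMap.isSelfAdjoint_iff_isSymmetric.2 hH)
  have h : symPart B - H = (1 / 2 : ℝ) • ((B - H) + ContinuousLinearMap.adjoint (B - H)) := by
    rw [map_sub, hadj, symPart]
    module
  rw [h, norm_smul]
  have h2 := norm_add_le (B - H) (ContinuousLinearMap.adjoint (B - H))
  rw [LinearIsometryEquiv.norm_map] at h2
  rw [Real.norm_of_nonneg (by norm_num)]
  linarith

theorem hasGradientAt_approxTaylor (f : EuclideanSpace ℝ (Fin n) → ℝ)
    (x : EuclideanSpace ℝ (Fin n))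
    (B : EuclideanSpace ℝ (Fin n) →L[ℝ] EuclideanSpace ℝ (Fin n)) (s : EuclideanSpace ℝ (Fin n)) :
    HasGradientAt (approxTaylor f x B) (gradient f x + symPart B s) s := by
  rw [hasGradientAt_iff_hasFDerivAt]
  have h1 : HasFDerivAt (fun s => inner ℝ (gradient f x) s) (innerSL ℝ (gradient f x)) s :=
    (innerSL ℝ (gradient f x)).hasFDerivAt
  have h2 := ((hasFDerivAt_id s).inner ℝ B.hasFDerivAt).const_mul (1 / 2)
  refine ((h1.const_add (f x)).add h2).congr_fderiv ?_
  ext v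
  simp [inner_symPart_left, fderivInnerCLM_apply]
  rw [real_inner_comm (B s) v]
  ring

theorem gradient_approxTaylor (f : EuclideanSpace ℝ (Fin n) → ℝ) (x : EuclideanSpace ℝ (Fin n))
    (B : EuclideanSpace ℝ (Fin n) →L[ℝ] EuclideanSpace ℝ (Fin n)) :
    gradient (approxTaylor f x B) = fun s => gradient f x + symPart B s :=
  gradient_eq (hasGradientAt_approxTaylor f x B)

theorem hessian_approxTaylor (f : EuclideanSpace ℝ (Fin n) → ℝ) (x s : EuclideanSpace ℝ (Fin n))
    (B : EuclideanSpace ℝ (Fin n) →L[ℝ] EuclideanSpace ℝ (Fin n)) :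
    hessian (approxTaylor f x B) s = symPart B := by
  rw [hessian, gradient_approxTaylor]
  exact ((symPart B).hasFDerivAt.const_add _).fderiv

end Curvature

/-! ### Taylor remainders and averaged Hessians -/

section Taylor

variable {n : ℕ} {f : EuclideanSpace ℝ (Fin n) → ℝ}

theorem contDiff_gradient (hf : ContDiff ℝ 2 f) : ContDiff ℝ 1 (gradient f) :=
  (InnerProductSpace.toDual ℝ (EuclideanSpace ℝ (Fin n))).symm.contDiff.comp
    (hf.fderiv_right (m := 1) (by norm_num))

theorem hasFDerivAt_gradient (hf : ContDiff ℝ 2 f) (y : EuclideanSpace ℝ (Fin n)) :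
    HasFDerivAt (gradient f) (hessian f y) y :=
  ((contDiff_gradient hf).differentiable (by norm_num) y).hasFDerivAt

theorem continuous_hessian (hf : ContDiff ℝ 2 f) : Continuous (hessian f) :=
  (contDiff_gradient hf).continuous_fderiv (by norm_num)

theorem hessian_isSymmetric (hf : ContDiff ℝ 2 f) (y : EuclideanSpace ℝ (Fin n)) :
    (hessian f y : EuclideanSpace ℝ (Fin n) →ₗ[ℝ] EuclideanSpace ℝ (Fin n)).IsSymmetric := by
  have hsymm : IsSymmSndFDerivAt ℝ f y := hf.contDiffAt.isSymmSndFDerivAt (by simp)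
  have key : ∀ u v, inner ℝ (hessian f y u) v = fderiv ℝ (fderiv ℝ f) y u v := by
    intro u v
    have h1 := ((InnerProductSpace.toDual ℝ (EuclideanSpace ℝ (Fin n))).hasFDerivAt.comp y
      (hasFDerivAt_gradient hf y)).fderiv
    have h2 : (InnerProductSpace.toDual ℝ (EuclideanSpace ℝ (Fin n))) ∘ gradient f = fderiv ℝ f :=
      toDual_comp_gradient
    rw [h2] at h1
    rw [h1]
    rfl
  intro u v
  change inner ℝ (hessian f y u) v = inner ℝ u (hessian f y v)
  rw [key, real_inner_comm, key]
  exact hsymm.eq u v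

theorem norm_gradient_sub_le {L : ℝ} (hf : ContDiff ℝ 2 f)
    (hLip : ∀ y z, ‖hessian f y - hessian f z‖ ≤ L * ‖y - z‖) (hL : 0 ≤ L)
    (x s : EuclideanSpace ℝ (Fin n)) :
    ‖gradient f (x + s) - gradient f x - hessian f x s‖ ≤ L * ‖s‖ ^ 2 := by
  have h := (convex_closedBall x ‖s‖).norm_image_sub_le_of_norm_hasFDerivWithin_le'
    (f := gradient f) (f' := hessian f) (φ := hessian f x) (C := L * ‖s‖) (x := x) (y := x + s)
    (fun y _ => (hasFDerivAt_gradient hf y).hasFDerivWithinAt)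
    (fun y hy => (hLip y x).trans (by
      gcongr; simpa [dist_eq_norm] using hy)) (by simp) (by simp [dist_eq_norm])
  rw [add_sub_cancel_left] at h
  calc _ ≤ _ := h
    _ = _ := by ring

/-- The remainder vanishes at `0` and its gradient is the remainder of `gradient f`, so the mean
value inequality applies again. The crude constant `L` in place of `L / 6` suffices. -/
theorem abs_sub_taylor_le {L : ℝ} (hf : ContDiff ℝ 2 f)
    (hLip : ∀ y z, ‖hessian f y - hessian f z‖ ≤ L * ‖y - z‖) (hL : 0 ≤ L)
    (x s : EuclideanSpace ℝ (Fin n)) :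
    |f (x + s) - approxTaylor f x (hessian f x) s| ≤ L * ‖s‖ ^ 3 := by
  set φ : EuclideanSpace ℝ (Fin n) → ℝ := fun s => f (x + s) - approxTaylor f x (hessian f x) s
  have hsym : symPart (hessian f x) = hessian f x :=
    sub_eq_zero.1 (norm_le_zero_iff.1
      ((norm_symPart_sub_le (hessian_isSymmetric hf x)).trans_eq (by simp)))
  have hd : ∀ v, HasFDerivAt φ (InnerProductSpace.toDual ℝ (EuclideanSpace ℝ (Fin n))
      (gradient f (x + v) - gradient f x - hessian f x v)) v := by
    intro v
    have h1 : HasFDerivAt (fun v => f (x + v)) (fderiv ℝ f (x + v)) v := by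
      have := ((hf.differentiable (by norm_num)) (x + v)).hasFDerivAt
      exact this.comp v ((hasFDerivAt_id v).const_add x)
    have h3 := (hasGradientAt_approxTaylor f x (hessian f x) v).hasFDerivAt
    rw [hsym] at h3
    refine (h1.sub h3).congr_fderiv ?_
    rw [← toDual_gradient, ← map_sub, sub_sub]
  have h := (convex_closedBall (0 : EuclideanSpace ℝ (Fin n))
    ‖s‖).norm_image_sub_le_of_norm_hasFDerivWithin_le
    (f := φ) (C := L * ‖s‖ ^ 2) (x := 0) (y := s)
    (fun v _ => (hd v).hasFDerivWithinAt)
    (fun v hv => by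
      rw [LinearIsometryEquiv.norm_map]
      refine (norm_gradient_sub_le hf hLip hL x v).trans ?_
      gcongr
      simpa using hv) (by simp) (by simp)
  have h0 : φ 0 = 0 := by simp [φ, approxTaylor]
  rw [h0, sub_zero, sub_zero, Real.norm_eq_abs] at h
  calc _ ≤ _ := h
    _ = _ := by ring

theorem norm_averagedHessian_sub_le {L : ℝ} (hf : ContDiff ℝ 2 f)
    (hLip : ∀ y z, ‖hessian f y - hessian f z‖ ≤ L * ‖y - z‖) (hL : 0 ≤ L)
    (x s z : EuclideanSpace ℝ (Fin n))
    (hz : ∀ t ∈ Set.Icc (0 : ℝ) 1, ‖x + t • s - z‖ ≤ ‖s‖) :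
    ‖averagedHessian f x s - hessian f z‖ ≤ L * ‖s‖ := by
  have hc : Continuous fun t : ℝ => hessian f (x + t • s) :=
    (continuous_hessian hf).comp (by fun_prop)
  have h1 : averagedHessian f x s - hessian f z =
      ∫ t in (0 : ℝ)..1, (hessian f (x + t • s) - hessian f z) := by
    rw [intervalIntegral.integral_sub (hc.intervalIntegrable _ _) (by simp)]
    simp [averagedHessian]
  rw [h1]
  have h2 := intervalIntegral.norm_integral_le_of_norm_le_const (a := (0 : ℝ)) (b := 1)
    (C := L * ‖s‖) (f := fun t => hessian f (x + t • s) - hessian f z) (by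
      intro t ht
      rw [Set.uIoc_of_le zero_le_one] at ht
      exact (hLip _ _).trans (by gcongr; exact hz t ⟨ht.1.le, ht.2⟩))
  simpa using h2

theorem norm_averagedHessian_sub_left_le {L : ℝ} (hf : ContDiff ℝ 2 f)
    (hLip : ∀ y z, ‖hessian f y - hessian f z‖ ≤ L * ‖y - z‖) (hL : 0 ≤ L)
    (x s : EuclideanSpace ℝ (Fin n)) :
    ‖averagedHessian f x s - hessian f x‖ ≤ L * ‖s‖ := by
  refine norm_averagedHessian_sub_le hf hLip hL x s x fun t ht => ?_
  rw [add_sub_cancel_left, norm_smul, Real.norm_eq_abs, abs_of_nonneg ht.1]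
  exact mul_le_of_le_one_left (norm_nonneg _) ht.2

theorem norm_averagedHessian_sub_right_le {L : ℝ} (hf : ContDiff ℝ 2 f)
    (hLip : ∀ y z, ‖hessian f y - hessian f z‖ ≤ L * ‖y - z‖) (hL : 0 ≤ L)
    (x s : EuclideanSpace ℝ (Fin n)) :
    ‖averagedHessian f x s - hessian f (x + s)‖ ≤ L * ‖s‖ := by
  refine norm_averagedHessian_sub_le hf hLip hL x s (x + s) fun t ht => ?_
  have : x + t • s - (x + s) = (t - 1) • s := by module
  rw [this, norm_smul, Real.norm_eq_abs, abs_sub_comm, abs_of_nonneg (sub_nonneg.2 ht.2)]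
  exact mul_le_of_le_one_left (norm_nonneg _) (by linarith [ht.1])

end Taylor

/-! ### From the algorithm to the scalar recursion -/

theorem sum_stepLength_eq_window {n : ℕ} (s : ℕ → EuclideanSpace ℝ (Fin n)) (m k : ℕ) :
    ∑ i ∈ Finset.Icc 1 m, stepLength s ((k : ℤ) - (i : ℤ)) = window (fun j => ‖s j‖) m k := by
  rw [window, Finset.range_eq_Ico, Finset.sum_Ico_add' (fun i => lag (fun j => ‖s j‖) i k) 0 m 1]
  refine Finset.sum_congr rfl fun i _ => ?_
  unfold stepLength lag
  by_cases h : k < i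
  · rw [if_pos (by omega), if_pos h]
  · rw [if_neg (by omega), if_neg h]
    congr 2
    omega

/-- Propagation of the Hessian error between refreshes. -/
theorem error_le_window {m : ℕ} {κA κC L : ℝ} {ω e : ℕ → ℝ} (hm : 1 ≤ m) (hκA : 0 ≤ κA)
    (hκC : 1 ≤ κC) (hL : 0 ≤ L) (hω : ∀ k, 0 ≤ ω k)
    (hr : ∀ k, k % m = 0 → e k ≤ κA * window ω m k)
    (hu : ∀ k, (k + 1) % m ≠ 0 → e (k + 1) ≤ κC * (e k + L * ω k) + L * ω k) (k : ℕ) :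
    e k ≤ κC ^ m * (κA + 2 * L) * window ω (2 * m) k := by
  have hκC0 : 0 ≤ κC := by linarith
  have hrefresh : ∀ k, k % m = 0 →
      e k ≤ κC ^ (k % m) * (κA + 2 * L) * window ω (m + k % m) k := by
    intro k hk
    rw [hk, pow_zero, one_mul, add_zero]
    refine (hr k hk).trans ?_
    have := window_nonneg hω m k
    gcongr
    linarith
  -- `k % m` counts the iterations since the last refresh: each one costs a factor `κC` and
  -- lengthens the window by one step.
  have hind : ∀ k, e k ≤ κC ^ (k % m) * (κA + 2 * L) * window ω (m + k % m) k := by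
    intro k
    induction k with
    | zero => exact hrefresh 0 (Nat.zero_mod m)
    | succ k ih =>
      by_cases hk : (k + 1) % m = 0
      · exact hrefresh _ hk
      have hmod : (k + 1) % m = k % m + 1 := by
        have h1 := Nat.mod_lt k hm
        rw [Nat.add_mod_eq_ite] at hk ⊢
        by_cases h2 : m = 1
        · subst h2; simp_all
        · have : 1 % m = 1 := Nat.mod_eq_of_lt (by omega)
          rw [this] at hk ⊢
          split_ifs with h3
          · rw [if_pos h3] at hk; omega
          · rfl
      rw [hmod, ← add_assoc, window_succ_succ]
      have hw := hω k
      have hpow : 1 ≤ κC ^ (k % m) := one_le_pow₀ hκC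
      have hLw : L * ω k ≤ κC * (L * ω k) := le_mul_of_one_le_left (by positivity) hκC
      calc e (k + 1) ≤ κC * (e k + L * ω k) + L * ω k := hu k hk
        _ ≤ κC * (e k + 2 * L * ω k) := by linarith
        _ ≤ κC * (κC ^ (k % m) * (κA + 2 * L) * window ω (m + k % m) k +
              κC ^ (k % m) * (κA + 2 * L) * ω k) := by
          have h2L : 2 * L ≤ κC ^ (k % m) * (κA + 2 * L) :=
            (by linarith : 2 * L ≤ κA + 2 * L).trans
              (le_mul_of_one_le_left (by positivity) hpow)
          exact mul_le_mul_of_nonneg_left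
            (add_le_add ih (mul_le_mul_of_nonneg_right h2L hw)) hκC0
        _ = _ := by ring
  refine (hind k).trans ?_
  have hlt := Nat.mod_lt k hm
  have h1 := window_nonneg hω (m + k % m) k
  have h2 := window_mono hω (by omega : m + k % m ≤ 2 * m) k
  have h3 : κC ^ (k % m) ≤ κC ^ m := pow_le_pow_right₀ hκC hlt.le
  gcongr

/-- The scalar relations hold along every run of the algorithm. -/
theorem IsRun.scalarRun {n m : ℕ} {θ₁ θ₂ κA κB κC σ₀ L : ℝ} {f : EuclideanSpace ℝ (Fin n) → ℝ}
    {x s : ℕ → EuclideanSpace ℝ (Fin n)}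
    {B : ℕ → EuclideanSpace ℝ (Fin n) →L[ℝ] EuclideanSpace ℝ (Fin n)} {σ : ℕ → ℝ}
    (h : IsRun m θ₁ θ₂ κA κB κC σ₀ f x s B σ) (hf : ContDiff ℝ 2 f)
    (hLip : ∀ y z, ‖hessian f y - hessian f z‖ ≤ L * ‖y - z‖) (hL : 0 ≤ L)
    (hm : 1 ≤ m) (hκA : 0 ≤ κA) (hκC : 1 ≤ κC) :
    ScalarRun (2 * m) (κC ^ m * (κA + 2 * L)) L θ₁ θ₂ σ₀ (fun k => ‖s k‖) σ (fun k => f (x k))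
      (fun k => ‖gradient f (x k)‖) (fun k => negCurvature f (x k))
      (fun k => ‖B k - hessian f (x k)‖) where
  step_nonneg _ := norm_nonneg _
  sigma_zero := h.sigma_zero
  sigma_succ := h.sigma_succ
  decrease k := by
    have h1 := (abs_le.1 (abs_sub_taylor_le hf hLip hL (x k) (s k))).2
    have h2 := h.model_decrease k
    have h3 := (abs_le.1 (inner_le_norm_mul_sq (B k - hessian f (x k)) (s k))).1
    simp only [model, approxTaylor, sub_apply, inner_sub_right, map_zero,
      inner_zero_right, norm_zero] at h1 h2 h3
    have h4 : 0 ≤ ‖B k - hessian f (x k)‖ * ‖s k‖ ^ 2 := by positivity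
    rw [h.iterate_succ]
    linarith
  step_le k := by
    have h2 := h.model_decrease k
    have h1 := (abs_le.1 (abs_real_inner_le_norm (gradient f (x k)) (s k))).1
    have h3 := (abs_le.1 (inner_le_norm_mul_sq (B k - hessian f (x k)) (s k))).1
    have h4 := neg_curvature_le_inner (hessian_isSymmetric hf (x k)) (s k)
    have h5 : 0 ≤ max 0 (-lambdaMin (hessian f (x k))) := le_max_left _ _
    simp only [model, approxTaylor, sub_apply, inner_sub_right, map_zero,
      inner_zero_right, norm_zero] at h2 h3
    -- `s · B s` is compared with `s · ∇²f s`, up to the error; the nonnegativity of `h6` and `h7`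
    -- allows the factor `1 / 2` to be dropped.
    have h6 : 0 ≤ ‖B k - hessian f (x k)‖ * ‖s k‖ ^ 2 := by positivity
    have h7 : 0 ≤ max 0 (-lambdaMin (hessian f (x k))) * ‖s k‖ ^ 2 := by positivity
    unfold negCurvature
    linarith
  gradient_succ k := by
    have h1 := norm_gradient_sub_le hf hLip hL (x k) (s k)
    have h2 := h.step_gradient k
    rw [gradient_approxTaylor] at h2
    have h3 : ‖(symPart (B k) - hessian f (x k)) (s k)‖ ≤ ‖B k - hessian f (x k)‖ * ‖s k‖ :=
      (ContinuousLinearMap.le_opNorm _ _).trans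
        (mul_le_mul_of_nonneg_right (norm_symPart_sub_le (hessian_isSymmetric hf _))
          (norm_nonneg _))
    have h4 : gradient f (x (k + 1)) =
        (gradient f (x k + s k) - gradient f (x k) - hessian f (x k) (s k)) +
        (gradient f (x k) + symPart (B k) (s k)) -
        (symPart (B k) - hessian f (x k)) (s k) := by
      rw [h.iterate_succ, sub_apply]
      abel
    rw [h4]
    refine (norm_sub_le _ _).trans ((add_le_add (norm_add_le _ _) le_rfl).trans ?_)
    linarith
  curvature_succ k := by
    -- The sign comes from the curvature test itself, whose left side is a maximum with `0`.
    have h0 : 0 ≤ θ₂ * σ k * ‖s k‖ := le_trans (le_max_left _ _) (h.step_curvature k)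
    have hc : 0 ≤ ‖B k - hessian f (x k)‖ + (L + θ₂ * σ k) * ‖s k‖ := by
      rw [add_mul]
      positivity
    refine curvature_le_of_inner hc fun v => ?_
    have h1 := neg_curvature_le_inner (symPart_isSymmetric (B k)) v
    have h2 := h.step_curvature k
    rw [negCurvature, hessian_approxTaylor] at h2
    have h3 := (abs_le.1 (inner_le_norm_mul_sq (B k - hessian f (x k)) v)).2
    have h4 := (abs_le.1 (inner_le_norm_mul_sq (hessian f (x (k + 1)) - hessian f (x k)) v)).1
    have h5 := hLip (x (k + 1)) (x k)
    rw [h.iterate_succ, add_sub_cancel_left, ← h.iterate_succ] at h5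
    have h6 := mul_le_mul_of_nonneg_right h5 (sq_nonneg ‖v‖)
    have h7 := mul_le_mul_of_nonneg_right h2 (sq_nonneg ‖v‖)
    rw [inner_symPart_self] at h1
    simp only [sub_apply, inner_sub_right] at h3 h4
    linarith
  error_le := by
    refine error_le_window hm hκA hκC hL (fun _ => norm_nonneg _) (fun k hk => ?_) fun k hk => ?_
    · rw [← sum_stepLength_eq_window]
      exact (h.refresh k hk).trans (min_le_left _ _)
    · have h1 := norm_averagedHessian_sub_left_le hf hLip hL (x k) (s k)
      have h2 := norm_averagedHessian_sub_right_le hf hLip hL (x k) (s k)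
      rw [← h.iterate_succ] at h2
      have h3 := norm_sub_le_norm_sub_add_norm_sub (B k) (hessian f (x k))
        (averagedHessian f (x k) (s k))
      have h4 := norm_sub_le_norm_sub_add_norm_sub (B (k + 1)) (averagedHessian f (x k) (s k))
        (hessian f (x (k + 1)))
      rw [norm_sub_rev] at h1
      refine h4.trans (add_le_add ((h.update k hk).trans ?_) h2)
      exact mul_le_mul_of_nonneg_left (h3.trans (add_le_add le_rfl h1)) (by linarith)

end ARApprox
theorem mainTheorem6 (m : ℕ) (θ₁ θ₂ κA κB κC σ₀ L Δ G β : ℝ)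
    (hm : 1 ≤ m) (hθ₁ : 1 < θ₁) (hθ₂ : 1 < θ₂) (hκA : 0 < κA) (hκB : 0 < κB) (hκC : 1 ≤ κC)
    (hσ₀ : 0 < σ₀) (hL : 3 ≤ L) :
    ∃ C₁ C₂ : ℝ, ∀ (n : ℕ) (f : EuclideanSpace ℝ (Fin n) → ℝ) (f_low : ℝ)
      (x s : ℕ → EuclideanSpace ℝ (Fin n))
      (B : ℕ → EuclideanSpace ℝ (Fin n) →L[ℝ] EuclideanSpace ℝ (Fin n)) (σ : ℕ → ℝ),
      ContDiff ℝ 2 f →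
      (∀ y, f_low ≤ f y) →
      (∀ y z, ‖ARApprox.hessian f y - ARApprox.hessian f z‖ ≤ L * ‖y - z‖) →
      ARApprox.IsRun m θ₁ θ₂ κA κB κC σ₀ f x s B σ →
      f (x 0) - f_low ≤ Δ →
      ‖gradient f (x 0)‖ ≤ G →
      ARApprox.negCurvature f (x 0) ≤ β →
      ∀ k : ℕ,
        (Finset.Icc 1 (k + 1)).inf' (Finset.nonempty_Icc.2 (Nat.le_add_left 1 k))
            (fun j => ‖gradient f (x j)‖) ≤ C₁ / ((k : ℝ) + 1) ^ (2 / 3 : ℝ) ∧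
        (Finset.Icc 1 (k + 1)).inf' (Finset.nonempty_Icc.2 (Nat.le_add_left 1 k))
            (fun j => ARApprox.negCurvature f (x j)) ≤ C₂ / ((k : ℝ) + 1) ^ (1 / 3 : ℝ) := by
  obtain ⟨C₁, C₂, hC⟩ := ARApprox.ScalarRun.exists_rate (2 * m) (κC ^ m * (κA + 2 * L)) L θ₁ θ₂ σ₀
    Δ G β (by positivity) (by linarith) (by linarith) (by linarith) hσ₀
  refine ⟨C₁, C₂, fun n f f_low x s B σ hf hlow hLip hrun hΔ hG hβ k => ?_⟩
  obtain ⟨j, hjk, h1, h2⟩ := hC _ _ _ _ _ _ f_low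
    (hrun.scalarRun hf hLip (by linarith) hm hκA.le hκC) (fun k => hlow _) hΔ hG hβ k
  have hmem : j + 1 ∈ Finset.Icc 1 (k + 1) := Finset.mem_Icc.2 ⟨by omega, by omega⟩
  exact ⟨(Finset.inf'_le _ hmem).trans h1, (Finset.inf'_le _ hmem).trans h2⟩
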